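/- Let $\mathbb H$ be a complex Hilbert space with inner product $\langle\cdot,\cdot\rangle$ (linear in the first variable) and let $T$ be a bounded linear operator on $\mathbb H$. For a bounded operator $S$ on $\mathbb H$ let $w(S)=\sup\{|\langle Sx,x\rangle| : x\in\mathbb H,\ \|x\|=1\}$ be its numerical radius and $\|S\|$ its operator norm. Let $|T|=(T^*T)^{1/2}$ and let $T=U|T|$ be the polar decomposition of $T$, where $U$ is the partial isometry with $\ker U=\ker T$. For $t\in[0,1]$ let $\widetilde{T}_t=|T|^tU|T|^{1-t}$ be the $t$-Aluthge transform of $T$, where $|T|^0$ means $U^*U$, and let $\widetilde T=|T|^{1/2}U|T|^{1/2}$ be the Aluthge transform of $T$. Then \[ w^2(T)\le \min_{t\in[0,1]}\left(\tfrac14 w\big(\widetilde{T}_t^{\,2}\big)+\tfrac14\|T\|\,\|\widetilde{T}_t\|\right)+\tfrac14\|T^*T+TT^*\|, \] where the minimum is attained. In particular, \[ w^2(T)\le \tfrac14 w\big(\widetilde{T}^{\,2}\big)+\tfrac14\|T\|\,\|\widetilde{T}\|+\tfrac14\|T^*T+TT^*\|. \] (On the zero space all quantities are $0$, with $w(0)=0$.)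 -/

import Mathlib

/-- The numerical range `W(T) = {⟨Tx, x⟩ : ‖x‖ = 1}`. Mathlib's inner product is conjugate-linear in
the first slot, so `⟨Tx, x⟩` is written `inner ℂ x (T x)`. -/
def numericalRange {H : Type*} [NormedAddCommGroup H] [InnerProductSpace ℂ H]
    (T : H →L[ℂ] H) : Set ℂ :=
  {z | ∃ x : H, ‖x‖ = 1 ∧ inner ℂ x (T x) = z}

/-- The numerical radius `w(T) = sup {|z| : z ∈ W(T)}`. The set is always bounded, by `‖T‖`; on the
zero space it is empty and `w(T) = 0`. -/
noncomputable def numericalRadius {H : Type*} [NormedAddCommGroup H] [InnerProductSpace ℂ H]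
    (T : H →L[ℂ] H) : ℝ :=
  sSup ((fun z : ℂ => ‖z‖) '' numericalRange T)

theorem numericalRadius_bddAbove {H : Type*} [NormedAddCommGroup H] [InnerProductSpace ℂ H]
    (T : H →L[ℂ] H) : BddAbove ((fun z : ℂ => ‖z‖) '' numericalRange T) := by
  refine ⟨‖T‖, ?_⟩
  rintro _ ⟨_, ⟨x, hx, rfl⟩, rfl⟩
  calc ‖inner ℂ x (T x)‖ ≤ ‖x‖ * ‖T x‖ := norm_inner_le_norm _ _
    _ ≤ ‖x‖ * (‖T‖ * ‖x‖) := by gcongr; exact T.le_opNorm x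
    _ = ‖T‖ := by rw [hx]; ring

section Polar

variable {H : Type*} [NormedAddCommGroup H] [InnerProductSpace ℂ H] [CompleteSpace H]

/-- The initial space of the polar decomposition: the closure of the range of
`|T| = (T* T)^{1/2}`. -/
noncomputable def polarInitialSpace (T : H →L[ℂ] H) : Submodule ℂ H :=
  (CFC.abs T).range.topologicalClosure

instance polarInitialSpace_completeSpace (T : H →L[ℂ] H) :
    CompleteSpace (polarInitialSpace T) :=
  (Submodule.isClosed_topologicalClosure _).completeSpace_coe

/-- `|T|` as a linear map with dense range into the closure of its range. -/
noncomputable def absToInitialSpace (T : H →L[ℂ] H) : H →ₗ[ℂ] polarInitialSpace T :=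
  LinearMap.codRestrict (polarInitialSpace T) ((CFC.abs T : H →L[ℂ] H) : H →ₗ[ℂ] H)
    (fun x => Submodule.le_topologicalClosure _ ⟨x, rfl⟩)

/-- The partial isometry `U` of the polar decomposition `T = U|T|`, `ker U = ker T`: it is the
continuous extension of `|T| x ↦ T x` to the closure of the range of `|T|`, and `0` on the
orthogonal complement. -/
noncomputable def polarPartialIsometry (T : H →L[ℂ] H) : H →L[ℂ] H :=
  ((T : H →ₗ[ℂ] H).extendOfNorm (absToInitialSpace T)).comp
    (polarInitialSpace T).orthogonalProjectionOnto

theorem norm_abs_apply (T : H →L[ℂ] H) (x : H) : ‖CFC.abs T x‖ = ‖T x‖ := by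
  have hs : ContinuousLinearMap.adjoint (CFC.abs T) = CFC.abs T :=
    (IsSelfAdjoint.of_nonneg (CFC.abs_nonneg T)).star_eq
  have h : CFC.abs T (CFC.abs T x) = ContinuousLinearMap.adjoint T (T x) :=
    congrArg (fun A : H →L[ℂ] H => A x) (CFC.abs_mul_abs T)
  have h2 : inner ℂ (CFC.abs T x) (CFC.abs T x) = inner ℂ (T x) (T x) := by
    rw [← ContinuousLinearMap.adjoint_inner_left, hs, h,
      ContinuousLinearMap.adjoint_inner_left]
  have h3 : ‖CFC.abs T x‖ ^ 2 = ‖T x‖ ^ 2 := by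
    rw [inner_self_eq_norm_sq_to_K, inner_self_eq_norm_sq_to_K] at h2
    exact_mod_cast h2
  exact (sq_eq_sq₀ (norm_nonneg _) (norm_nonneg _)).1 h3

theorem absToInitialSpace_denseRange (T : H →L[ℂ] H) : DenseRange (absToInitialSpace T) := by
  intro y
  rw [Topology.IsEmbedding.subtypeVal.closure_eq_preimage_closure_image]
  have hy : (y : H) ∈ closure ((CFC.abs T).range : Set H) := by
    rw [← Submodule.topologicalClosure_coe]
    exact y.2
  refine closure_mono ?_ hy
  rintro _ ⟨x, rfl⟩
  exact ⟨absToInitialSpace T x, ⟨x, rfl⟩, rfl⟩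

theorem extend_absToInitialSpace (T : H →L[ℂ] H) (x : H) :
    (T : H →ₗ[ℂ] H).extendOfNorm (absToInitialSpace T) (absToInitialSpace T x) = T x := by
  refine LinearMap.extendOfNorm_eq (absToInitialSpace_denseRange T) ⟨1, fun z => ?_⟩ x
  rw [one_mul]
  exact (norm_abs_apply T z).ge

theorem norm_extend_absToInitialSpace (T : H →L[ℂ] H) (y : polarInitialSpace T) :
    ‖(T : H →ₗ[ℂ] H).extendOfNorm (absToInitialSpace T) y‖ = ‖y‖ := by
  refine (absToInitialSpace_denseRange T).induction_on
    (p := fun y => ‖(T : H →ₗ[ℂ] H).extendOfNorm (absToInitialSpace T) y‖ = ‖y‖) y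
    (isClosed_eq (by fun_prop) (by fun_prop)) fun x => ?_
  rw [extend_absToInitialSpace]
  exact (norm_abs_apply T x).symm

/-- `T = U|T|`. -/
theorem polarPartialIsometry_mul_abs (T : H →L[ℂ] H) :
    polarPartialIsometry T * CFC.abs T = T := by
  ext x
  have h : (polarInitialSpace T).orthogonalProjectionOnto (CFC.abs T x) = absToInitialSpace T x :=
    Submodule.orthogonalProjectionOnto_mem_subspace_eq_self (absToInitialSpace T x)
  change (T : H →ₗ[ℂ] H).extendOfNorm (absToInitialSpace T)
    ((polarInitialSpace T).orthogonalProjectionOnto (CFC.abs T x)) = T x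
  rw [h, extend_absToInitialSpace]

theorem polarInitialSpace_orthogonal (T : H →L[ℂ] H) : (polarInitialSpace T)ᗮ = T.ker := by
  have hs : ContinuousLinearMap.adjoint (CFC.abs T) = CFC.abs T :=
    (IsSelfAdjoint.of_nonneg (CFC.abs_nonneg T)).star_eq
  rw [polarInitialSpace, Submodule.orthogonal_closure, ContinuousLinearMap.orthogonal_range, hs]
  ext x
  have := norm_abs_apply T x
  constructor
  · intro h
    have h0 : CFC.abs T x = 0 := h
    rw [h0, norm_zero] at this
    exact norm_eq_zero.1 this.symm
  · intro h
    have h0 : T x = 0 := h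
    rw [h0, norm_zero] at this
    exact norm_eq_zero.1 this

/-- `ker U = ker T`. -/
theorem polarPartialIsometry_ker (T : H →L[ℂ] H) : (polarPartialIsometry T).ker = T.ker := by
  rw [← polarInitialSpace_orthogonal T]
  ext x
  have h : ‖polarPartialIsometry T x‖ = ‖(polarInitialSpace T).orthogonalProjectionOnto x‖ :=
    norm_extend_absToInitialSpace T _
  rw [← Submodule.orthogonalProjectionOnto_eq_zero_iff (K := polarInitialSpace T), ← norm_eq_zero, ← h, norm_eq_zero]
  rfl

/-- `U` is a partial isometry: it is isometric on the orthogonal complement of its kernel. -/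
theorem norm_polarPartialIsometry_apply (T : H →L[ℂ] H) (x : H)
    (hx : x ∈ (polarPartialIsometry T).kerᗮ) : ‖polarPartialIsometry T x‖ = ‖x‖ := by
  rw [polarPartialIsometry_ker, ← polarInitialSpace_orthogonal,
    Submodule.orthogonal_orthogonal] at hx
  have h : ‖polarPartialIsometry T x‖ = ‖(polarInitialSpace T).orthogonalProjectionOnto x‖ :=
    norm_extend_absToInitialSpace T _
  have h2 : (polarInitialSpace T).orthogonalProjectionOnto x = ⟨x, hx⟩ :=
    Submodule.orthogonalProjectionOnto_mem_subspace_eq_self (⟨x, hx⟩ : polarInitialSpace T)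
  rw [h, h2]
  rfl

/-- The two conditions `T = V|T|` and `ker V = ker T` determine `V`. -/
theorem polarPartialIsometry_unique (T V : H →L[ℂ] H) (hV : V * CFC.abs T = T)
    (hk : V.ker = T.ker) : V = polarPartialIsometry T := by
  have key : ∀ y ∈ polarInitialSpace T, V y = polarPartialIsometry T y := by
    intro y hy
    rw [polarInitialSpace, ← SetLike.mem_coe, Submodule.topologicalClosure_coe] at hy
    refine closure_minimal (s := ((CFC.abs T).range : Set H))
      (t := {y | V y = polarPartialIsometry T y}) ?_
      (isClosed_eq (by fun_prop) (by fun_prop)) hy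
    rintro _ ⟨x, rfl⟩
    exact congrArg (fun A : H →L[ℂ] H => A x) (hV.trans (polarPartialIsometry_mul_abs T).symm)
  ext x
  obtain ⟨y, hy, z, hz, rfl⟩ := (polarInitialSpace T).exists_add_mem_mem_orthogonal x
  rw [polarInitialSpace_orthogonal] at hz
  have h1 : V z = 0 := by rw [← hk] at hz; exact hz
  have h2 : polarPartialIsometry T z = 0 := by
    rw [← polarPartialIsometry_ker] at hz; exact hz
  rw [map_add, map_add, h1, h2, key y hy]

open Classical in
/-- The powers `|T|^s`, `s ≥ 0`, with the convention `|T|^0 = U* U` (rather than the identity, which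
is what the functional calculus gives). -/
noncomputable def absPow (T : H →L[ℂ] H) (s : ℝ) : H →L[ℂ] H :=
  if s = 0 then star (polarPartialIsometry T) * polarPartialIsometry T else CFC.abs T ^ s

/-- The `t`-Aluthge transform `|T|^t U |T|^{1-t}`. -/
noncomputable def tAluthge (t : ℝ) (T : H →L[ℂ] H) : H →L[ℂ] H :=
  absPow T t * polarPartialIsometry T * absPow T (1 - t)

/-- The Aluthge transform `|T|^{1/2} U |T|^{1/2}`. -/
noncomputable def aluthge (T : H →L[ℂ] H) : H →L[ℂ] H :=
  CFC.abs T ^ (1 / 2 : ℝ) * polarPartialIsometry T * CFC.abs T ^ (1 / 2 : ℝ)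

end Polar

/-! Two numerical radius inequalities give the bound. `numericalRadius_sq_le` bounds `w(T)²` by `½
w(T²)` plus the term in `T*T + TT*`. `numericalRadius_mul_le` compares `w(AB)` with `w(BA)`. With `q
= |T|^{1-t}` and `p = |T|^t` one has `T = Uqp`, so `T² = (Uq)(T̃ₜp)`, while the reversed product
`(T̃ₜp)(Uq)` is `T̃ₜ²`; moreover `‖Uq‖‖T̃ₜp‖ ≤ ‖T‖‖T̃ₜ‖`.

The minimum is attained because `t ↦ |T|^t`, hence `t ↦ T̃ₜ`, is bounded and strongly continuous on
`[0, 1]`. Norm and numerical radius are suprema of strongly continuous functions, so the quantity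
minimized is lower semicontinuous on a compact interval. -/

open ContinuousLinearMap

/-! ### Numerical radius inequalities for `T²` and for products `AB`, `BA`. -/

section NumericalRadius

variable {H : Type*} [NormedAddCommGroup H] [InnerProductSpace ℂ H]

theorem numericalRadius_nonneg (T : H →L[ℂ] H) : 0 ≤ numericalRadius T := by
  refine Real.sSup_nonneg ?_
  rintro _ ⟨z, _, rfl⟩
  exact norm_nonneg z

theorem norm_inner_apply_le_numericalRadius (T : H →L[ℂ] H) {x : H} (hx : ‖x‖ = 1) :
    ‖inner ℂ x (T x)‖ ≤ numericalRadius T :=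
  le_csSup (numericalRadius_bddAbove T) ⟨_, ⟨x, hx, rfl⟩, rfl⟩

theorem numericalRadius_le {T : H →L[ℂ] H} {c : ℝ} (hc : 0 ≤ c)
    (h : ∀ x, ‖x‖ = 1 → ‖inner ℂ x (T x)‖ ≤ c) : numericalRadius T ≤ c := by
  refine Real.sSup_le ?_ hc
  rintro _ ⟨_, ⟨x, hx, rfl⟩, rfl⟩
  exact h x hx

theorem norm_inner_apply_le_numericalRadius_mul_sq (T : H →L[ℂ] H) (x : H) :
    ‖inner ℂ x (T x)‖ ≤ numericalRadius T * ‖x‖ ^ 2 := by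
  rcases eq_or_ne x 0 with rfl | hx
  · simp
  have hx' : ‖x‖ ≠ 0 := norm_ne_zero_iff.2 hx
  have h := norm_inner_apply_le_numericalRadius T (x := ((‖x‖⁻¹ : ℝ) : ℂ) • x) (by
    rw [norm_smul]; simp [hx'])
  rw [map_smul, inner_smul_left, inner_smul_right, norm_mul, norm_mul] at h
  simp only [Complex.conj_ofReal, Complex.norm_real, norm_inv, norm_norm] at h
  calc ‖inner ℂ x (T x)‖ = (‖x‖⁻¹ * (‖x‖⁻¹ * ‖inner ℂ x (T x)‖)) * ‖x‖ ^ 2 := by field_simp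
    _ ≤ _ := by gcongr

theorem numericalRadius_smul_of_norm_eq_one (T : H →L[ℂ] H) {c : ℂ} (hc : ‖c‖ = 1) :
    numericalRadius (c • T) = numericalRadius T := by
  have h : ∀ x, ‖inner ℂ x ((c • T) x)‖ = ‖inner ℂ x (T x)‖ := fun x => by
    rw [smul_apply, inner_smul_right, norm_mul, hc, one_mul]
  refine le_antisymm (numericalRadius_le (numericalRadius_nonneg _) fun x hx => ?_)
    (numericalRadius_le (numericalRadius_nonneg _) fun x hx => ?_)
  · rw [h]; exact norm_inner_apply_le_numericalRadius T hx
  · rw [← h]; exact norm_inner_apply_le_numericalRadius _ hx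

theorem exists_norm_eq_one_mul_eq_norm (z : ℂ) : ∃ c : ℂ, ‖c‖ = 1 ∧ c * z = ‖z‖ := by
  rcases eq_or_ne z 0 with rfl | hz
  · exact ⟨1, by simp, by simp⟩
  · have hz' : (‖z‖ : ℂ) ≠ 0 := by exact_mod_cast norm_ne_zero_iff.2 hz
    refine ⟨(starRingEnd ℂ) z / ‖z‖, by simp [hz], ?_⟩
    rw [div_mul_eq_mul_div, mul_comm, Complex.mul_conj, Complex.normSq_eq_norm_sq]
    push_cast
    field_simp

variable [CompleteSpace H]

theorem norm_apply_sq_add_norm_adjoint_apply_sq_le (T : H →L[ℂ] H) {x : H} (hx : ‖x‖ = 1) :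
    ‖T x‖ ^ 2 + ‖adjoint T x‖ ^ 2 ≤ ‖star T * T + T * star T‖ := by
  have h : ((‖T x‖ ^ 2 + ‖adjoint T x‖ ^ 2 : ℝ) : ℂ)
      = inner ℂ x ((star T * T + T * star T) x) := by
    change _ = inner ℂ x (adjoint T (T x) + T (adjoint T x))
    rw [inner_add_right, adjoint_inner_right, ← adjoint_inner_left T (adjoint T x) x,
      inner_self_eq_norm_sq_to_K, inner_self_eq_norm_sq_to_K]
    push_cast
    rfl
  calc ‖T x‖ ^ 2 + ‖adjoint T x‖ ^ 2
      = ‖((‖T x‖ ^ 2 + ‖adjoint T x‖ ^ 2 : ℝ) : ℂ)‖ := by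
        rw [Complex.norm_real, Real.norm_of_nonneg (by positivity)]
    _ ≤ ‖x‖ * ‖(star T * T + T * star T) x‖ := by rw [h]; exact norm_inner_le_norm _ _
    _ ≤ ‖x‖ * (‖star T * T + T * star T‖ * ‖x‖) := by gcongr; exact le_opNorm _ x
    _ = _ := by rw [hx]; ring

/-- `w(T)² ≤ ½ w(T²) + ¼ ‖T*T + TT*‖`. -/
theorem numericalRadius_sq_le (T : H →L[ℂ] H) :
    numericalRadius T ^ 2
      ≤ 1 / 2 * numericalRadius (T ^ 2) + 1 / 4 * ‖star T * T + T * star T‖ := by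
  set C := 1 / 2 * numericalRadius (T ^ 2) + 1 / 4 * ‖star T * T + T * star T‖ with hC
  have hw := numericalRadius_nonneg (T ^ 2)
  have hC0 : 0 ≤ C := by positivity
  suffices h : numericalRadius T ≤ √C by
    calc numericalRadius T ^ 2 ≤ √C ^ 2 := by gcongr; exact numericalRadius_nonneg T
      _ = C := Real.sq_sqrt hC0
  refine numericalRadius_le (Real.sqrt_nonneg _) fun x hx => Real.le_sqrt_of_sq_le ?_
  -- The rotation `c` gives `cTx` and its adjoint counterpart `c̄T*x` the same real inner product
  -- `n` with `x`. Hence `2n ≤ ‖a + b‖`, and the cross term of the square is `c²⟨T²x, x⟩`.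
  obtain ⟨c, hc, hcz⟩ := exists_norm_eq_one_mul_eq_norm (inner ℂ x (T x))
  set n := ‖inner ℂ x (T x)‖
  set a := c • T x
  set b := (starRingEnd ℂ) c • adjoint T x
  have ha : ‖a‖ = ‖T x‖ := by rw [norm_smul, hc, one_mul]
  have hb : ‖b‖ = ‖adjoint T x‖ := by rw [norm_smul, RCLike.norm_conj, hc, one_mul]
  have hxa : inner ℂ x a = (n : ℂ) := by rw [inner_smul_right, hcz]
  have hxb : inner ℂ x b = (n : ℂ) := by
    rw [inner_smul_right, adjoint_inner_right, ← inner_conj_symm, ← map_mul, hcz,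
      Complex.conj_ofReal]
  have h1 : 2 * n ≤ ‖a + b‖ := by
    calc 2 * n = ‖inner ℂ x (a + b)‖ := by
          rw [inner_add_right, hxa, hxb, ← Complex.ofReal_add, Complex.norm_real,
            Real.norm_of_nonneg (by positivity)]
          ring
      _ ≤ ‖x‖ * ‖a + b‖ := norm_inner_le_norm _ _
      _ = _ := by rw [hx, one_mul]
  have h2 : RCLike.re (inner ℂ b a) ≤ numericalRadius (T ^ 2) := by
    calc RCLike.re (inner ℂ b a) ≤ ‖inner ℂ b a‖ := RCLike.re_le_norm _
      _ = ‖inner ℂ x ((T ^ 2) x)‖ := by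
        rw [inner_smul_left, inner_smul_right, adjoint_inner_left, norm_mul, norm_mul]
        simp only [RCLike.norm_conj, hc, one_mul, pow_two]
        rfl
      _ ≤ _ := norm_inner_apply_le_numericalRadius _ hx
  have h3 : ‖a + b‖ ^ 2 = ‖b‖ ^ 2 + 2 * RCLike.re (inner ℂ b a) + ‖a‖ ^ 2 := by
    rw [add_comm, norm_add_sq (𝕜 := ℂ)]
  have h4 := norm_apply_sq_add_norm_adjoint_apply_sq_le T hx
  have h5 : (2 * n) ^ 2 ≤ ‖a + b‖ ^ 2 := by gcongr
  rw [h3, ha, hb] at h5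
  linarith

/-- The vector Cauchy–Schwarz inequality for a positive operator. -/
theorem norm_apply_sq_le_of_nonneg {P : H →L[ℂ] H} (hP : 0 ≤ P) (x : H) :
    ‖P x‖ ^ 2 ≤ ‖P‖ * RCLike.re (inner ℂ x (P x)) := by
  have hq : adjoint (CFC.sqrt P) = CFC.sqrt P :=
    (IsSelfAdjoint.of_nonneg (CFC.sqrt_nonneg P)).star_eq
  have hs : ∀ y, P y = CFC.sqrt P (CFC.sqrt P y) := fun y =>
    congrArg (fun A : H →L[ℂ] H => A y) (CFC.sqrt_mul_sqrt_self P).symm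
  have h1 : RCLike.re (inner ℂ x (P x)) = ‖CFC.sqrt P x‖ ^ 2 := by
    rw [hs, ← adjoint_inner_left, hq, inner_self_eq_norm_sq (𝕜 := ℂ)]
  have h2 : ‖CFC.sqrt P‖ ^ 2 = ‖P‖ := by
    rw [CFC.norm_sqrt P, Real.sq_sqrt (norm_nonneg _)]
  calc ‖P x‖ ^ 2 ≤ (‖CFC.sqrt P‖ * ‖CFC.sqrt P x‖) ^ 2 := by
        rw [hs]; gcongr; exact le_opNorm _ _
    _ = _ := by rw [mul_pow, h1, h2]

/-- The operator `S = AB + (AB)*` is the row `[A, B*]` times the column `[B; A*]`. The swapped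
product is the block matrix `[[BA, BB*], [A*A, A*B*]]`: its diagonal is controlled by `w(BA)` and
its off-diagonal by `‖A‖²` and `‖B‖²`. Approximate eigenvectors `y` of `S` for the top `M` of its
numerical range transfer to the pair `(By, A*y)`, which bounds `M`. -/
theorem re_inner_mul_apply_le (A B : H →L[ℂ] H) {x : H} (hx : ‖x‖ = 1) :
    2 * RCLike.re (inner ℂ x ((A * B) x))
      ≤ numericalRadius (B * A) + (‖A‖ ^ 2 + ‖B‖ ^ 2) / 2 := by
  set w := numericalRadius (B * A)
  have hw : 0 ≤ w := numericalRadius_nonneg _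
  set K := w + (‖A‖ ^ 2 + ‖B‖ ^ 2) / 2 with hK
  have hK0 : 0 ≤ K := by positivity
  set S : H →L[ℂ] H := A * B + star (A * B) with hS
  have hSa : IsSelfAdjoint S := IsSelfAdjoint.add_star_self _
  have hSx : ∀ y, S y = A (B y) + adjoint B (adjoint A y) := fun y => by
    rw [hS, star_mul]; rfl
  have hSre : ∀ y, RCLike.re (inner ℂ y (S y)) = 2 * RCLike.re (inner ℂ y ((A * B) y)) := by
    intro y
    rw [hSx, inner_add_right, adjoint_inner_right, adjoint_inner_right, map_add,
      show (A * B) y = A (B y) from rfl,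
      ← inner_conj_symm (A (B y)) y, RCLike.conj_re]
    ring
  set V : Set ℝ := (fun y => RCLike.re (inner ℂ y (S y))) '' {y : H | ‖y‖ = 1} with hV
  have hbdd : BddAbove V := by
    refine ⟨‖S‖, ?_⟩
    rintro _ ⟨y, hy, rfl⟩
    have hy : ‖y‖ = 1 := hy
    calc RCLike.re (inner ℂ y (S y)) ≤ ‖inner ℂ y (S y)‖ := RCLike.re_le_norm _
      _ ≤ ‖y‖ * ‖S y‖ := norm_inner_le_norm _ _
      _ ≤ ‖y‖ * (‖S‖ * ‖y‖) := by gcongr; exact S.le_opNorm y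
      _ = ‖S‖ := by rw [hy]; ring
  have hne : V.Nonempty := ⟨_, x, hx, rfl⟩
  set M := sSup V with hM
  rw [← hSre]
  refine (le_csSup hbdd ⟨x, hx, rfl⟩).trans (?_ : M ≤ K)
  by_contra! hKM
  have hM0 : 0 < M := hK0.trans_lt hKM
  -- Since `P ≥ 0`, smallness of `⟨Py, y⟩` forces smallness of `‖Py‖`: near-maximizers of `⟨Sy, y⟩`
  -- are approximate eigenvectors.
  set P : H →L[ℂ] H := (M : ℂ) • 1 - S with hP
  have hPx : ∀ y, P y = (M : ℂ) • y - S y := fun y => rfl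
  have sq : ∀ z : H, RCLike.re (inner ℂ z ((M : ℂ) • z)) = M * ‖z‖ ^ 2 := fun z => by
    rw [inner_smul_right, RCLike.re_to_complex, Complex.re_ofReal_mul, ← RCLike.re_to_complex,
      inner_self_eq_norm_sq]
  have hPre : ∀ y, RCLike.re (inner ℂ y (P y)) = M * ‖y‖ ^ 2 - RCLike.re (inner ℂ y (S y)) := by
    intro y
    rw [hPx, inner_sub_right, map_sub, sq]
  have hPpos : 0 ≤ P := by
    rw [nonneg_iff_isPositive, isPositive_def']
    refine ⟨?_, fun y => ?_⟩
    · refine IsSelfAdjoint.sub (IsSelfAdjoint.smul ?_ (.one _)) hSa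
      exact Complex.conj_ofReal M
    rw [reApplyInnerSelf_apply, ← inner_conj_symm, RCLike.conj_re, hPre, sub_nonneg]
    rcases eq_or_ne y 0 with rfl | hy
    · simp
    have hy' : ‖y‖ ≠ 0 := norm_ne_zero_iff.2 hy
    have h : RCLike.re (inner ℂ (((‖y‖⁻¹ : ℝ) : ℂ) • y) (S (((‖y‖⁻¹ : ℝ) : ℂ) • y))) ≤ M :=
      le_csSup hbdd ⟨_, by simp [norm_smul, hy'], rfl⟩
    rw [map_smul, inner_smul_left, inner_smul_right, Complex.conj_ofReal, RCLike.re_to_complex,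
      Complex.re_ofReal_mul, Complex.re_ofReal_mul] at h
    calc RCLike.re (inner ℂ y (S y))
        = (‖y‖⁻¹ * (‖y‖⁻¹ * (inner ℂ y (S y)).re)) * ‖y‖ ^ 2 := by
          rw [RCLike.re_to_complex]; field_simp
      _ ≤ _ := by gcongr
  set C := ‖B‖ ^ 2 + ‖A‖ ^ 2
  -- Applying `B` and `A*` to `My = Sy + Py` gives the block system for `(u, v)`, up to an error of
  -- size `‖Py‖`. Pairing with `u` and `v` and using `‖u‖‖v‖ ≤ (‖u‖² + ‖v‖²)/2` leaves exactly the
  -- constant `K`.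
  have key : ∀ y, ‖y‖ = 1 → (M - K) * RCLike.re (inner ℂ y (S y)) ≤ C * ‖P y‖ := by
    intro y hy
    set u := B y with hu
    set v := adjoint A y with hv
    set r := P y with hr
    have hSy : S y = A u + adjoint B v := hSx y
    have hMy : (M : ℂ) • y = A u + adjoint B v + r := by rw [hr, hPx, ← hSy]; abel
    have hun : ‖u‖ ≤ ‖B‖ := by simpa [hy] using B.le_opNorm y
    have hA' : ‖adjoint A‖ = ‖A‖ := LinearIsometryEquiv.norm_map _ _
    have hB' : ‖adjoint B‖ = ‖B‖ := LinearIsometryEquiv.norm_map _ _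
    have hvn : ‖v‖ ≤ ‖A‖ := by simpa [hy, hA'] using (adjoint A).le_opNorm y
    have hMu : (M : ℂ) • u = B (A u) + B (adjoint B v) + B r := by
      rw [← map_add, ← map_add, ← hMy, map_smul]
    have hMv : (M : ℂ) • v = adjoint A (A u) + adjoint A (adjoint B v) + adjoint A r := by
      rw [← map_add, ← map_add, ← hMy, map_smul]
    have cs : ∀ (D : H →L[ℂ] H) (p q : H), RCLike.re (inner ℂ p (D q)) ≤ ‖p‖ * (‖D‖ * ‖q‖) :=
      fun D p q => (RCLike.re_le_norm _).trans ((norm_inner_le_norm _ _).trans (by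
        gcongr; exact D.le_opNorm q))
    have e1 : M * ‖u‖ ^ 2 ≤ w * ‖u‖ ^ 2 + ‖B‖ ^ 2 * (‖u‖ * ‖v‖) + ‖B‖ ^ 2 * ‖r‖ := by
      rw [← sq, hMu, inner_add_right, inner_add_right, map_add, map_add]
      gcongr
      · exact (RCLike.re_le_norm _).trans (norm_inner_apply_le_numericalRadius_mul_sq (B * A) u)
      · calc _ ≤ ‖u‖ * (‖B‖ * ‖adjoint B v‖) := cs _ _ _
          _ ≤ ‖u‖ * (‖B‖ * (‖B‖ * ‖v‖)) := by
            gcongr; rw [← hB']; exact le_opNorm _ _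
          _ = _ := by ring
      · calc _ ≤ ‖u‖ * (‖B‖ * ‖r‖) := cs _ _ _
          _ ≤ ‖B‖ * (‖B‖ * ‖r‖) := by gcongr
          _ = _ := by ring
    have e2 : M * ‖v‖ ^ 2 ≤ ‖A‖ ^ 2 * (‖u‖ * ‖v‖) + w * ‖v‖ ^ 2 + ‖A‖ ^ 2 * ‖r‖ := by
      rw [← sq, hMv, inner_add_right, inner_add_right, map_add, map_add]
      gcongr
      · calc _ ≤ ‖v‖ * (‖adjoint A‖ * ‖A u‖) := cs _ _ _
          _ ≤ ‖v‖ * (‖A‖ * (‖A‖ * ‖u‖)) := by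
            rw [hA']; gcongr; exact le_opNorm _ _
          _ = _ := by ring
      · rw [adjoint_inner_right, adjoint_inner_right, ← inner_conj_symm, RCLike.conj_re]
        exact (RCLike.re_le_norm _).trans (norm_inner_apply_le_numericalRadius_mul_sq (B * A) v)
      · calc _ ≤ ‖v‖ * (‖adjoint A‖ * ‖r‖) := cs _ _ _
          _ ≤ ‖A‖ * (‖A‖ * ‖r‖) := by rw [hA']; gcongr
          _ = _ := by ring
    have e3 : RCLike.re (inner ℂ y (S y)) ≤ ‖u‖ ^ 2 + ‖v‖ ^ 2 := by
      have h : RCLike.re (inner ℂ y (S y)) ≤ 2 * (‖v‖ * ‖u‖) := by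
        rw [hSre, show (A * B) y = A (B y) from rfl, ← adjoint_inner_left]
        gcongr
        exact (RCLike.re_le_norm _).trans (norm_inner_le_norm _ _)
      nlinarith [sq_nonneg (‖u‖ - ‖v‖)]
    have e4 : C * (‖u‖ * ‖v‖) ≤ C * ((‖u‖ ^ 2 + ‖v‖ ^ 2) / 2) := by
      gcongr
      nlinarith [sq_nonneg (‖u‖ - ‖v‖)]
    calc _ ≤ (M - K) * (‖u‖ ^ 2 + ‖v‖ ^ 2) := by gcongr
      _ ≤ C * ‖r‖ := by simp only [C, hK] at *; linarith
  -- Along a maximizing sequence `key` tends to `(M - K)M ≤ 0`, contradicting `M > K ≥ 0`.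
  obtain ⟨s, -, hs, hsV⟩ := exists_seq_tendsto_sSup hne hbdd
  choose y hy hys using hsV
  have hlim : Filter.Tendsto (fun n => C * √(‖P‖ * (M - s n))) Filter.atTop (nhds 0) := by
    have : Filter.Tendsto (fun n => C * √(‖P‖ * (M - s n))) Filter.atTop
        (nhds (C * √(‖P‖ * (M - M)))) := ((hs.const_sub M).const_mul _).sqrt.const_mul _
    simpa using this
  have h0 : (M - K) * M ≤ 0 := by
    refine le_of_tendsto_of_tendsto' (hs.const_mul (M - K)) hlim fun n => ?_
    rw [← hys n]
    refine (key _ (hy n)).trans ?_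
    gcongr
    refine Real.le_sqrt_of_sq_le ((norm_apply_sq_le_of_nonneg hPpos _).trans_eq ?_)
    rw [hPre, show ‖y n‖ = 1 from hy n]
    ring
  exact absurd (mul_pos (sub_pos.2 hKM) hM0) h0.not_gt

/-- `w(AB) ≤ ½ (w(BA) + ‖A‖‖B‖)`. -/
theorem numericalRadius_mul_le (A B : H →L[ℂ] H) :
    numericalRadius (A * B) ≤ 1 / 2 * (numericalRadius (B * A) + ‖A‖ * ‖B‖) := by
  have hw := numericalRadius_nonneg (B * A)
  refine numericalRadius_le (by positivity) fun x hx => ?_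
  rcases eq_or_ne A 0 with rfl | hA
  · simpa using hw
  rcases eq_or_ne B 0 with rfl | hB
  · simpa using hw
  have hA0 : 0 < ‖A‖ := norm_pos_iff.2 hA
  have hB0 : 0 < ‖B‖ := norm_pos_iff.2 hB
  obtain ⟨c, hc, hcz⟩ := exists_norm_eq_one_mul_eq_norm (inner ℂ x ((A * B) x))
  -- This scaling makes `‖sA‖ = ‖s⁻¹B‖`, so the mean of the squared norms becomes `‖A‖‖B‖`; `AB` and
  -- `BA` are unaffected.
  set s := √(‖B‖ / ‖A‖) with hs
  have hs0 : 0 < s := Real.sqrt_pos.2 (by positivity)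
  have hs2 : s ^ 2 = ‖B‖ / ‖A‖ := Real.sq_sqrt (by positivity)
  have hsC : (s : ℂ) ≠ 0 := by exact_mod_cast hs0.ne'
  have h := re_inner_mul_apply_le ((c * s : ℂ) • A) ((s⁻¹ : ℂ) • B) hx
  have e1 : ((c * s : ℂ) • A) * ((s⁻¹ : ℂ) • B) = c • (A * B) := by
    rw [smul_mul_smul_comm, mul_assoc, mul_inv_cancel₀ hsC, mul_one]
  have e2 : ((s⁻¹ : ℂ) • B) * ((c * s : ℂ) • A) = c • (B * A) := by
    rw [smul_mul_smul_comm, mul_comm c, ← mul_assoc, inv_mul_cancel₀ hsC, one_mul]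
  rw [e1, e2, numericalRadius_smul_of_norm_eq_one _ hc, smul_apply, inner_smul_right, hcz,
    norm_smul, norm_smul, norm_mul, hc, one_mul, norm_inv, Complex.norm_real,
    Real.norm_of_nonneg hs0.le, mul_pow, mul_pow, inv_pow, hs2, RCLike.re_to_complex,
    Complex.ofReal_re] at h
  have e3 : (‖B‖ / ‖A‖ * ‖A‖ ^ 2 + (‖B‖ / ‖A‖)⁻¹ * ‖B‖ ^ 2) / 2 = ‖A‖ * ‖B‖ := by
    field_simp
    ring
  rw [e3] at h
  linarith

end NumericalRadius

/-! ### Powers of `|T|` and the bound for each `t`. -/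

section AluthgeTransform

variable {H : Type*} [NormedAddCommGroup H] [InnerProductSpace ℂ H] [CompleteSpace H]

theorem norm_polarPartialIsometry_le (T : H →L[ℂ] H) : ‖polarPartialIsometry T‖ ≤ 1 := by
  refine opNorm_le_bound _ zero_le_one fun x => ?_
  have h : ‖polarPartialIsometry T x‖ = ‖(polarInitialSpace T).orthogonalProjectionOnto x‖ :=
    norm_extend_absToInitialSpace T _
  rw [h, one_mul]
  exact Submodule.norm_orthogonalProjectionOnto_apply_le _ x

theorem inner_polarPartialIsometry_abs (T : H →L[ℂ] H) (x y : H) :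
    inner ℂ (polarPartialIsometry T (CFC.abs T x)) (polarPartialIsometry T (CFC.abs T y))
      = inner ℂ (CFC.abs T x) (CFC.abs T y) := by
  have hU : ∀ z, polarPartialIsometry T (CFC.abs T z) = T z := fun z =>
    congrArg (fun A : H →L[ℂ] H => A z) (polarPartialIsometry_mul_abs T)
  have hs : adjoint (CFC.abs T) = CFC.abs T :=
    (IsSelfAdjoint.of_nonneg (CFC.abs_nonneg T)).star_eq
  have h : CFC.abs T (CFC.abs T y) = adjoint T (T y) :=
    congrArg (fun A : H →L[ℂ] H => A y) (CFC.abs_mul_abs T)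
  rw [hU, hU, ← adjoint_inner_right T, ← h, ← adjoint_inner_left, hs]

/-- `U*U|T| = |T|`. -/
theorem star_polarPartialIsometry_mul_self_mul_abs (T : H →L[ℂ] H) :
    star (polarPartialIsometry T) * polarPartialIsometry T * CFC.abs T = CFC.abs T := by
  set U := polarPartialIsometry T with hU
  have hs : adjoint (CFC.abs T) = CFC.abs T :=
    (IsSelfAdjoint.of_nonneg (CFC.abs_nonneg T)).star_eq
  ext x
  set q := CFC.abs T x with hq
  change adjoint U (U q) = q
  have h1 : ‖adjoint U (U q)‖ ≤ ‖q‖ := by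
    have hU1 : ‖adjoint U‖ ≤ 1 :=
      (LinearIsometryEquiv.norm_map _ _).trans_le (norm_polarPartialIsometry_le T)
    have hU2 : ‖U‖ ≤ 1 := norm_polarPartialIsometry_le T
    calc ‖adjoint U (U q)‖ ≤ 1 * ‖U q‖ := (adjoint U).le_of_opNorm_le hU1 _
      _ ≤ 1 * (1 * ‖q‖) := by gcongr; exact U.le_of_opNorm_le hU2 _
      _ = ‖q‖ := by ring
  have h2 : RCLike.re (inner ℂ (adjoint U (U q)) q) = ‖q‖ ^ 2 := by
    rw [adjoint_inner_left, hq, hU, inner_polarPartialIsometry_abs, inner_self_eq_norm_sq]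
  -- Equality case of Cauchy–Schwarz: a vector no longer than `q` whose inner product with `q` has
  -- real part `‖q‖²` is `q`.
  have h3 : ‖adjoint U (U q) - q‖ ^ 2 ≤ 0 := by
    rw [norm_sub_sq (𝕜 := ℂ), h2]
    have : ‖adjoint U (U q)‖ ^ 2 ≤ ‖q‖ ^ 2 := by gcongr
    linarith
  exact sub_eq_zero.1 (norm_eq_zero.1 (pow_eq_zero_iff two_ne_zero |>.1
    (le_antisymm h3 (by positivity))))

theorem absPow_zero (T : H →L[ℂ] H) :
    absPow T 0 = star (polarPartialIsometry T) * polarPartialIsometry T := if_pos rfl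

theorem absPow_of_ne_zero (T : H →L[ℂ] H) {s : ℝ} (hs : s ≠ 0) : absPow T s = CFC.abs T ^ s :=
  if_neg hs

theorem absPow_one (T : H →L[ℂ] H) : absPow T 1 = CFC.abs T := by
  rw [absPow_of_ne_zero T one_ne_zero, CFC.rpow_one _ (CFC.abs_nonneg T)]

theorem norm_absPow_le (T : H →L[ℂ] H) {s : ℝ} (hs : 0 ≤ s) : ‖absPow T s‖ ≤ ‖T‖ ^ s := by
  rcases hs.eq_or_lt with rfl | hs
  · rw [absPow_zero, Real.rpow_zero]
    have h := norm_polarPartialIsometry_le T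
    calc _ ≤ ‖star (polarPartialIsometry T)‖ * ‖polarPartialIsometry T‖ := norm_mul_le _ _
      _ ≤ 1 * 1 := by rw [norm_star]; gcongr
      _ = 1 := one_mul 1
  · rw [absPow_of_ne_zero T hs.ne', CFC.norm_rpow _ hs (CFC.abs_nonneg T), CFC.norm_abs]

theorem isSelfAdjoint_absPow (T : H →L[ℂ] H) (s : ℝ) : IsSelfAdjoint (absPow T s) := by
  rcases eq_or_ne s 0 with rfl | hs
  · rw [absPow_zero]
    exact IsSelfAdjoint.star_mul_self _
  · rw [absPow_of_ne_zero T hs]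
    exact IsSelfAdjoint.of_nonneg CFC.rpow_nonneg

/-- Strict positivity of both exponents makes invertibility of `a` unnecessary. -/
theorem rpow_add_of_pos {a : H →L[ℂ] H} {s t : ℝ} (hs : 0 < s) (ht : 0 < t) :
    a ^ (s + t) = a ^ s * a ^ t := by
  lift s to NNReal using hs.le
  lift t to NNReal using ht.le
  have hs' : 0 < s := by exact_mod_cast hs
  have ht' : 0 < t := by exact_mod_cast ht
  rw [← NNReal.coe_add, ← CFC.nnrpow_eq_rpow (by positivity), ← CFC.nnrpow_eq_rpow hs',
    ← CFC.nnrpow_eq_rpow ht', CFC.nnrpow_add hs' ht']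

theorem absPow_mul_abs (T : H →L[ℂ] H) {s : ℝ} (hs : 0 ≤ s) :
    absPow T s * CFC.abs T = CFC.abs T ^ (s + 1) := by
  rcases hs.eq_or_lt with rfl | hs
  · rw [absPow_zero, star_polarPartialIsometry_mul_self_mul_abs, zero_add,
      CFC.rpow_one _ (CFC.abs_nonneg T)]
  · rw [absPow_of_ne_zero T hs.ne', rpow_add_of_pos hs one_pos,
      CFC.rpow_one _ (CFC.abs_nonneg T)]

theorem absPow_one_sub_mul_absPow (T : H →L[ℂ] H) {t : ℝ} (ht : t ∈ Set.Icc (0 : ℝ) 1) :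
    absPow T (1 - t) * absPow T t = CFC.abs T := by
  have h0 : absPow T 0 * absPow T 1 = CFC.abs T := by
    rw [absPow_one, absPow_mul_abs T le_rfl, zero_add, CFC.rpow_one _ (CFC.abs_nonneg T)]
  rcases ht.1.eq_or_lt with rfl | h1
  -- The case `t = 0` is the adjoint of the case `t = 1`.
  · have := congrArg star h0
    rwa [star_mul, (isSelfAdjoint_absPow T 0).star_eq, (isSelfAdjoint_absPow T 1).star_eq,
      (IsSelfAdjoint.of_nonneg (CFC.abs_nonneg T)).star_eq, ← sub_zero (1 : ℝ)] at this
  rcases ht.2.eq_or_lt with rfl | h2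
  · rwa [sub_self]
  rw [absPow_of_ne_zero T h1.ne', absPow_of_ne_zero T (sub_pos.2 h2).ne',
    ← rpow_add_of_pos (sub_pos.2 h2) h1, sub_add_cancel, CFC.rpow_one _ (CFC.abs_nonneg T)]

/-- `w(T²) ≤ ½ (w(T̃ₜ²) + ‖T‖‖T̃ₜ‖)`. -/
theorem numericalRadius_sq_le_tAluthge (T : H →L[ℂ] H) {t : ℝ} (ht : t ∈ Set.Icc (0 : ℝ) 1) :
    numericalRadius (T ^ 2)
      ≤ 1 / 2 * (numericalRadius (tAluthge t T ^ 2) + ‖T‖ * ‖tAluthge t T‖) := by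
  set U := polarPartialIsometry T
  set p := absPow T t with hp
  set q := absPow T (1 - t) with hq
  have hqp : q * p = CFC.abs T := absPow_one_sub_mul_absPow T ht
  have hT : U * (q * p) = T := by rw [hqp]; exact polarPartialIsometry_mul_abs T
  have hD : tAluthge t T = p * U * q := rfl
  have h := numericalRadius_mul_le (U * q) (tAluthge t T * p)
  have e1 : U * q * (tAluthge t T * p) = T ^ 2 := by
    calc U * q * (tAluthge t T * p) = (U * (q * p)) * (U * (q * p)) := by
          rw [hD]; simp only [mul_assoc]
      _ = T ^ 2 := by rw [hT, pow_two]
  have e2 : tAluthge t T * p * (U * q) = tAluthge t T ^ 2 := by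
    rw [pow_two]; nth_rw 3 [hD]; simp only [mul_assoc]
  rw [e1, e2] at h
  have hT1 : ‖T‖ ^ (1 - t) * ‖T‖ ^ t = ‖T‖ := by
    rw [← Real.rpow_add_of_nonneg (norm_nonneg _) (sub_nonneg.2 ht.2) ht.1, sub_add_cancel,
      Real.rpow_one]
  have hn : ‖U * q‖ * ‖tAluthge t T * p‖ ≤ ‖T‖ * ‖tAluthge t T‖ := by
    calc ‖U * q‖ * ‖tAluthge t T * p‖
        ≤ (‖U‖ * ‖q‖) * (‖tAluthge t T‖ * ‖p‖) := by gcongr <;> exact norm_mul_le _ _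
      _ ≤ (1 * ‖T‖ ^ (1 - t)) * (‖tAluthge t T‖ * ‖T‖ ^ t) := by
        gcongr
        · exact norm_polarPartialIsometry_le T
        · exact norm_absPow_le T (sub_nonneg.2 ht.2)
        · exact norm_absPow_le T ht.1
      _ = (‖T‖ ^ (1 - t) * ‖T‖ ^ t) * ‖tAluthge t T‖ := by ring
      _ = _ := by rw [hT1]
  linarith

theorem numericalRadius_sq_le_add_tAluthge (T : H →L[ℂ] H) {t : ℝ}
    (ht : t ∈ Set.Icc (0 : ℝ) 1) :
    numericalRadius T ^ 2 ≤ 1 / 4 * numericalRadius (tAluthge t T ^ 2)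
      + 1 / 4 * ‖T‖ * ‖tAluthge t T‖ + 1 / 4 * ‖star T * T + T * star T‖ := by
  have h1 := numericalRadius_sq_le T
  have h2 := numericalRadius_sq_le_tAluthge T ht
  linarith

theorem tAluthge_one_half (T : H →L[ℂ] H) : tAluthge (1 / 2) T = aluthge T := by
  unfold tAluthge aluthge
  rw [show (1 : ℝ) - 1 / 2 = 1 / 2 by norm_num, absPow_of_ne_zero T (by norm_num)]

end AluthgeTransform

/-! ### Strong continuity in `t` and attainment of the minimum. -/

section StrongContinuity

variable {H : Type*} [NormedAddCommGroup H] [InnerProductSpace ℂ H]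

/-- A family of operators that is bounded and continuous in the strong operator topology on `s`. -/
def StronglyContinuousOn (F : ℝ → H →L[ℂ] H) (s : Set ℝ) : Prop :=
  (∃ C, ∀ t ∈ s, ‖F t‖ ≤ C) ∧ ∀ x, ContinuousOn (fun t => F t x) s

theorem StronglyContinuousOn.const (A : H →L[ℂ] H) (s : Set ℝ) :
    StronglyContinuousOn (fun _ => A) s :=
  ⟨⟨‖A‖, fun _ _ => le_rfl⟩, fun _ => continuousOn_const⟩

/-- Split `F r (g r)` as `F r (g r - g t) + F r (g t)`; the uniform bound on `‖F r‖` kills the first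
term. This is what makes products strongly continuous. -/
theorem StronglyContinuousOn.continuousOn_apply {F : ℝ → H →L[ℂ] H} {g : ℝ → H} {s : Set ℝ}
    (hF : StronglyContinuousOn F s) (hg : ContinuousOn g s) :
    ContinuousOn (fun t => F t (g t)) s := by
  obtain ⟨⟨C, hC⟩, hF⟩ := hF
  intro t ht
  have h1 : Filter.Tendsto (fun r => F r (g r - g t)) (nhdsWithin t s) (nhds 0) := by
    refine squeeze_zero_norm' (a := fun r => C * ‖g r - g t‖) ?_ ?_
    · filter_upwards [self_mem_nhdsWithin] with r hr
      exact (F r).le_of_opNorm_le (hC r hr) _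
    · have := (((hg t ht).tendsto.sub_const (g t)).norm).const_mul C
      simpa using this
  have h2 := h1.add (hF (g t) t ht).tendsto
  simpa [ContinuousWithinAt] using h2

theorem StronglyContinuousOn.mul {F G : ℝ → H →L[ℂ] H} {s : Set ℝ}
    (hF : StronglyContinuousOn F s) (hG : StronglyContinuousOn G s) :
    StronglyContinuousOn (fun t => F t * G t) s := by
  refine ⟨?_, fun x => hF.continuousOn_apply (hG.2 x)⟩
  obtain ⟨C, hC⟩ := hF.1
  obtain ⟨D, hD⟩ := hG.1
  refine ⟨C * D, fun t ht => (norm_mul_le _ _).trans ?_⟩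
  exact mul_le_mul (hC t ht) (hD t ht) (norm_nonneg _) ((norm_nonneg _).trans (hC t ht))

theorem StronglyContinuousOn.comp {F : ℝ → H →L[ℂ] H} {g : ℝ → ℝ} {s r : Set ℝ}
    (hF : StronglyContinuousOn F s) (hg : ContinuousOn g r) (h : Set.MapsTo g r s) :
    StronglyContinuousOn (fun t => F (g t)) r :=
  ⟨hF.1.imp fun _ hC _ ht => hC _ (h ht), fun x => (hF.2 x).comp hg h⟩

/-- The hypothesis says that `f` is pointwise a supremum of continuous minorants. -/
theorem lowerSemicontinuousOn_of_forall_exists {f : ℝ → ℝ} {s : Set ℝ}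
    (h : ∀ t ∈ s, ∀ y < f t, ∃ g : ℝ → ℝ, ContinuousOn g s ∧ (∀ r ∈ s, g r ≤ f r) ∧ y < g t) :
    LowerSemicontinuousOn f s := by
  intro t ht y hy
  obtain ⟨g, hg, hgf, hyg⟩ := h t ht y hy
  filter_upwards [(hg t ht).eventually (lt_mem_nhds hyg), self_mem_nhdsWithin] with r hr hrs
  exact hr.trans_le (hgf r hrs)

theorem StronglyContinuousOn.lowerSemicontinuousOn_norm {F : ℝ → H →L[ℂ] H} {s : Set ℝ}
    (hF : StronglyContinuousOn F s) : LowerSemicontinuousOn (fun t => ‖F t‖) s := by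
  refine lowerSemicontinuousOn_of_forall_exists fun t _ y hy => ?_
  by_cases hy0 : y < 0
  · exact ⟨fun _ => 0, continuousOn_const, fun _ _ => norm_nonneg _, hy0⟩
  push Not at hy0
  obtain ⟨x, hx⟩ : ∃ x, y * ‖x‖ < ‖F t x‖ := by
    by_contra! h
    exact hy.not_ge (opNorm_le_bound _ hy0 h)
  have hx0 : 0 < ‖x‖ := by
    rw [norm_pos_iff]
    rintro rfl
    simp at hx
  exact ⟨fun r => ‖F r x‖ / ‖x‖, (hF.2 x).norm.div_const _,
    fun r _ => (F r).ratio_le_opNorm x, (lt_div_iff₀ hx0).2 hx⟩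

theorem StronglyContinuousOn.lowerSemicontinuousOn_numericalRadius {F : ℝ → H →L[ℂ] H}
    {s : Set ℝ} (hF : StronglyContinuousOn F s) :
    LowerSemicontinuousOn (fun t => numericalRadius (F t)) s := by
  refine lowerSemicontinuousOn_of_forall_exists fun t _ y hy => ?_
  by_cases hy0 : y < 0
  · exact ⟨fun _ => 0, continuousOn_const, fun _ _ => numericalRadius_nonneg _, hy0⟩
  push Not at hy0
  obtain ⟨x, hx, hxy⟩ : ∃ x, ‖x‖ = 1 ∧ y < ‖inner ℂ x (F t x)‖ := by
    by_contra! h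
    exact hy.not_ge (numericalRadius_le hy0 h)
  exact ⟨fun r => ‖inner ℂ x (F r x)‖, (continuousOn_const.inner (𝕜 := ℂ) (hF.2 x)).norm,
    fun r _ => norm_inner_apply_le_numericalRadius _ hx, hxy⟩

variable [CompleteSpace H]

/-- The powers `a ^ (t + 1)` depend norm-continuously on `t ∈ [0, 1]`. -/
theorem continuousOn_rpow_add_one {a : H →L[ℂ] H} (ha : 0 ≤ a) :
    ContinuousOn (fun t : ℝ => a ^ (t + 1)) (Set.Icc 0 1) := by
  have he : (fun t : ℝ => a ^ (t + 1)) = fun t => cfc (fun x : ℝ => x ^ (t + 1)) a := by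
    funext t
    exact CFC.rpow_eq_cfc_real ha
  have hcont : ContinuousOn (fun p : ℝ × ℝ => p.2 ^ (p.1 + 1))
      (Set.Icc 0 1 ×ˢ spectrum ℝ a) := by
    -- The shift by one keeps the exponent positive, so joint continuity survives at `x = 0`.
    refine continuousOn_snd.rpow (continuousOn_fst.add continuousOn_const) fun p hp => Or.inr ?_
    linarith [hp.1.1]
  have hK : IsCompact (Set.Icc (0 : ℝ) 1 ×ˢ spectrum ℝ a) :=
    isCompact_Icc.prod (ContinuousFunctionalCalculus.isCompact_spectrum a)
  have huc := hK.uniformContinuousOn_of_continuous hcont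
  rw [he]
  intro t ht
  refine continuousWithinAt_cfc_fun ?_ ?_
  · rw [Metric.tendstoUniformlyOn_iff]
    rw [Metric.uniformContinuousOn_iff] at huc
    intro ε hε
    obtain ⟨δ, hδ, h⟩ := huc ε hε
    filter_upwards [self_mem_nhdsWithin, mem_nhdsWithin_of_mem_nhds (Metric.ball_mem_nhds t hδ)]
      with r hr hrt x hx
    refine h (t, x) ⟨ht, hx⟩ (r, x) ⟨hr, hx⟩ ?_
    rw [Prod.dist_eq, dist_self, max_eq_left dist_nonneg, dist_comm]
    exact hrt
  · filter_upwards [self_mem_nhdsWithin] with r hr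
    exact continuousOn_id.rpow_const fun _ _ => Or.inr (by linarith [hr.1])

/-- As `‖|T|^s x‖² = ⟨|T|^{2s} x, x⟩`, vanishing passes from exponent `2s` to `s`, hence from `1` to
every `2⁻ⁿ`. A positive `t` exceeds some `2⁻ⁿ`, and `|T|^t` then factors through that power. -/
theorem absPow_apply_eq_zero (T : H →L[ℂ] H) {t : ℝ} (ht : 0 ≤ t) {x : H} (hx : T x = 0) :
    absPow T t x = 0 := by
  have hstep : ∀ s : ℝ, 0 < s → (CFC.abs T ^ (s + s)) x = 0 → (CFC.abs T ^ s) x = 0 := by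
    intro s hs h
    have hsa : adjoint (CFC.abs T ^ s) = CFC.abs T ^ s :=
      (IsSelfAdjoint.of_nonneg CFC.rpow_nonneg).star_eq
    rw [rpow_add_of_pos hs hs] at h
    have h' : (CFC.abs T ^ s) ((CFC.abs T ^ s) x) = 0 := h
    rw [← inner_self_eq_zero (𝕜 := ℂ), ← adjoint_inner_right, hsa, h', inner_zero_right]
  have hpow : ∀ n : ℕ, (CFC.abs T ^ ((1 / 2 : ℝ) ^ n)) x = 0 := by
    intro n
    induction n with
    | zero =>
      rw [pow_zero, CFC.rpow_one _ (CFC.abs_nonneg T), ← norm_eq_zero, norm_abs_apply, hx,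
        norm_zero]
    | succ n ih =>
      refine hstep _ (by positivity) ?_
      rwa [show (1 / 2 : ℝ) ^ (n + 1) + (1 / 2) ^ (n + 1) = (1 / 2) ^ n by ring]
  rcases ht.eq_or_lt with rfl | ht
  · have hU : polarPartialIsometry T x = 0 := by
      have : x ∈ (polarPartialIsometry T).ker := by rw [polarPartialIsometry_ker]; exact hx
      exact this
    rw [absPow_zero]
    change adjoint (polarPartialIsometry T) (polarPartialIsometry T x) = 0
    rw [hU, map_zero]
  · obtain ⟨n, hn⟩ := exists_pow_lt_of_lt_one ht (show (1 / 2 : ℝ) < 1 by norm_num)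
    rw [absPow_of_ne_zero T ht.ne', ← sub_add_cancel t ((1 / 2) ^ n),
      rpow_add_of_pos (sub_pos.2 hn) (by positivity)]
    change (CFC.abs T ^ (t - (1 / 2) ^ n)) ((CFC.abs T ^ ((1 / 2 : ℝ) ^ n)) x) = 0
    rw [hpow, map_zero]

theorem norm_absPow_le_max (T : H →L[ℂ] H) {t : ℝ} (ht : t ∈ Set.Icc (0 : ℝ) 1) :
    ‖absPow T t‖ ≤ max 1 ‖T‖ := by
  refine (norm_absPow_le T ht.1).trans ?_
  calc ‖T‖ ^ t ≤ (max 1 ‖T‖) ^ t := by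
        gcongr
        · exact ht.1
        · exact le_max_right _ _
    _ ≤ (max 1 ‖T‖) ^ (1 : ℝ) := Real.rpow_le_rpow_of_exponent_le (le_max_left _ _) ht.2
    _ = _ := Real.rpow_one _

/-- On `ker T` the family vanishes. On the range of `|T|` it acts by `|T|^t |T| = |T|^{t+1}`, which
is norm continuous; at `t = 0` this relies on `|T|^0 = U*U`. The uniform bound extends continuity to
the closure of the range. Norm continuity at `t = 0` fails when `0` is an accumulation point of the
spectrum of `|T|`. -/
theorem stronglyContinuousOn_absPow (T : H →L[ℂ] H) :
    StronglyContinuousOn (absPow T) (Set.Icc 0 1) := by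
  refine ⟨⟨max 1 ‖T‖, fun t ht => norm_absPow_le_max T ht⟩, fun x => ?_⟩
  obtain ⟨y, hy, z, hz, rfl⟩ := (polarInitialSpace T).exists_add_mem_mem_orthogonal x
  have hz' : ContinuousOn (fun t => absPow T t z) (Set.Icc 0 1) := by
    rw [polarInitialSpace_orthogonal] at hz
    exact continuousOn_const.congr fun t ht => absPow_apply_eq_zero T ht.1 hz
  suffices hy' : ContinuousOn (fun t => absPow T t y) (Set.Icc 0 1) by
    exact (hy'.add hz').congr fun t _ => map_add (absPow T t) y z
  rw [polarInitialSpace, ← SetLike.mem_coe, Submodule.topologicalClosure_coe,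
    Metric.mem_closure_iff] at hy
  have hC : 0 < max 1 ‖T‖ := lt_max_of_lt_left one_pos
  refine continuousOn_of_uniform_approx_of_continuousOn fun u hu => ?_
  obtain ⟨ε, hε, hεu⟩ := Metric.mem_uniformity_dist.1 hu
  obtain ⟨_, ⟨v, rfl⟩, hv⟩ := hy (ε / max 1 ‖T‖) (by positivity)
  refine ⟨fun t => absPow T t (CFC.abs T v), ?_, fun t ht => hεu ?_⟩
  · refine ((continuousOn_rpow_add_one (CFC.abs_nonneg T)).clm_apply
      (continuousOn_const (c := v))).congr fun t ht => ?_
    exact congrArg (fun A : H →L[ℂ] H => A v) (absPow_mul_abs T ht.1)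
  · rw [dist_eq_norm] at hv ⊢
    rw [← map_sub]
    calc _ ≤ max 1 ‖T‖ * ‖y - CFC.abs T v‖ :=
          (absPow T t).le_of_opNorm_le (norm_absPow_le_max T ht) _
      _ < max 1 ‖T‖ * (ε / max 1 ‖T‖) := by gcongr; exact hv
      _ = ε := by field_simp

theorem stronglyContinuousOn_tAluthge (T : H →L[ℂ] H) :
    StronglyContinuousOn (fun t => tAluthge t T) (Set.Icc 0 1) := by
  have h := stronglyContinuousOn_absPow T
  have h' : StronglyContinuousOn (fun t => absPow T (1 - t)) (Set.Icc 0 1) :=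
    h.comp (continuousOn_const.sub continuousOn_id) fun t ht =>
      ⟨sub_nonneg.2 ht.2, sub_le_self _ ht.1⟩
  exact (h.mul (.const (polarPartialIsometry T) _)).mul h'

theorem lowerSemicontinuousOn_tAluthge_bound (T : H →L[ℂ] H) :
    LowerSemicontinuousOn (fun t : ℝ => 1 / 4 * numericalRadius (tAluthge t T ^ 2)
        + 1 / 4 * ‖T‖ * ‖tAluthge t T‖) (Set.Icc 0 1) := by
  have h := stronglyContinuousOn_tAluthge T
  have h2 : StronglyContinuousOn (fun t => tAluthge t T ^ 2) (Set.Icc 0 1) := by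
    simpa only [pow_two] using h.mul h
  have hmul : ∀ c : ℝ, 0 ≤ c → Monotone (c * ·) := fun c hc _ _ hab =>
    mul_le_mul_of_nonneg_left hab hc
  exact ((continuous_const_mul _).comp_lowerSemicontinuousOn
      h2.lowerSemicontinuousOn_numericalRadius (hmul _ (by norm_num))).add
    ((continuous_const_mul _).comp_lowerSemicontinuousOn
      h.lowerSemicontinuousOn_norm (hmul _ (by positivity)))

end StrongContinuity

theorem mainTheorem1 {H : Type*} [NormedAddCommGroup H] [InnerProductSpace ℂ H] [CompleteSpace H]
    (T : H →L[ℂ] H) :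
    (∃ m : ℝ,
      IsLeast ((fun t : ℝ => 1 / 4 * numericalRadius (tAluthge t T ^ 2)
        + 1 / 4 * ‖T‖ * ‖tAluthge t T‖) '' Set.Icc 0 1) m ∧
      numericalRadius T ^ 2 ≤ m + 1 / 4 * ‖star T * T + T * star T‖) ∧
    numericalRadius T ^ 2 ≤ 1 / 4 * numericalRadius (aluthge T ^ 2)
      + 1 / 4 * ‖T‖ * ‖aluthge T‖ + 1 / 4 * ‖star T * T + T * star T‖ := by
  constructor
  · obtain ⟨t, ht, hmin⟩ := (lowerSemicontinuousOn_tAluthge_bound T).exists_isMinOn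
      (Set.nonempty_Icc.2 zero_le_one) isCompact_Icc
    refine ⟨_, ⟨⟨t, ht, rfl⟩, ?_⟩, numericalRadius_sq_le_add_tAluthge T ht⟩
    rintro _ ⟨r, hr, rfl⟩
    exact hmin hr
  · rw [← tAluthge_one_half]
    exact numericalRadius_sq_le_add_tAluthge T (by norm_num)
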